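/- Consider a sequence of stochastic block models whose number of vertices $N$ tends to infinity. The vertex set $V$ of size $N$ is divided into $M=M(N)$ disjoint blocks of equal size $N/M$, where $M$ divides $N$ and $M=o(N)$ (for instance, $M$ is constant), and $p=p(N),q=q(N)\in[0,1]$. Every unordered pair $\{v,w\}$ of vertices (with $v=w$ allowed, so that loops occur) is an edge, independently of all other pairs, with probability $p$ if $v,w$ lie in the same block and with probability $q$ otherwise. The degree $d_v$ of a vertex is the number of $w\in V$ such that $\{v,w\}$ is an edge. For simple random walk on a realization of this random graph (from $v$, the next position is uniform among the $d_v$ neighbours of $v$), let $H_{vw}\in[0,\infty]$ be the expected time that the walk started at $v$ takes to reach $w$ (so $H_{vv}=0$), let $\pi_w=d_w/\sum_{u\in V}d_u$, and set $$H^v=\sum_{w\in V}\pi_w H_{vw}.$$ **Theorem.** Assume that $$\frac{M\log^4 N}{Np+N(M-1)q}\longrightarrow 0\qquad\text{and}\qquad q\gg\sqrt{\frac{p\log N}{NM}}\,,$$ and that the limit $\kappa=\lim_{N\to\infty}\frac{(M-1)q}{p}\in[0,\infty]$ exists. Then $H^v=N(1+o(1))$ asymptotically almost surely; that is, for every $\varepsilon>0$,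 $$\mathbb P\left(\,H^v<\infty\ \text{ and }\ \left|\frac{H^v}{N}-1\right|\le\varepsilon\ \text{ for all } v\in V\right)\longrightarrow 1 .$$ Here $a\gg b$ means $b=o(a)$, and the first condition means $M\log^4N=o(Np+N(M-1)q)$. -/

import Mathlib

open MeasureTheory ProbabilityTheory Filter Topology Asymptotics
open scoped ENNReal

namespace StochasticBlockModel

/-- A realization of a graph on the vertices `0, …, N - 1`, in which loops are allowed: for every
unordered pair `s(v, w)`, where `v = w` is possible, it records whether `{v, w}` is an edge. -/
abbrev EdgeConfig (N : ℕ) : Type := Sym2 (Fin N) → Bool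

/-- The probability of the edge `e`, for the block assignment `B`: it is `p` if both endpoints lie
in the same block, and `q` otherwise. -/
def edgeProb {N M : ℕ} (B : Fin N → Fin M) (p q : unitInterval) (e : Sym2 (Fin N)) :
    unitInterval :=
  Sym2.lift ⟨fun v w => if B v = B w then p else q, fun v w => by simp only [eq_comm]⟩ e

/-- The law of the stochastic block model: all edges (loops included) are independent, and the
edge `e` is present with probability `edgeProb B p q e`. -/
noncomputable def law {N M : ℕ} (B : Fin N → Fin M) (p q : unitInterval) :
    Measure (EdgeConfig N) :=
  Measure.pi fun e => bernoulliMeasure true false (edgeProb B p q e)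

/-- The neighbours of `v`; the vertex `v` itself is one of them if there is a loop at `v`. -/
def neighbors {N : ℕ} (G : EdgeConfig N) (v : Fin N) : Finset (Fin N) :=
  Finset.univ.filter fun w => G s(v, w) = true

/-- The degree of `v`; a loop at `v` counts once. -/
def degree {N : ℕ} (G : EdgeConfig N) (v : Fin N) : ℕ := (neighbors G v).card

/-- The law of one step of simple random walk from `v`: a uniformly chosen neighbour of `v`.
(If `v` has no neighbour, then the walk stays at `v`.) -/
noncomputable def stepLaw {N : ℕ} (G : EdgeConfig N) (v : Fin N) : Measure (Fin N) :=
  if (neighbors G v).Nonempty then uniformOn (neighbors G v : Set (Fin N)) else Measure.dirac v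

instance {N : ℕ} (G : EdgeConfig N) (v : Fin N) : IsProbabilityMeasure (stepLaw G v) := by
  unfold stepLaw
  split_ifs with h
  · exact isProbabilityMeasure_uniformOn (Finset.finite_toSet _) (by exact_mod_cast h)
  · infer_instance

/-- The transition kernel of simple random walk on `G`. -/
noncomputable def stepKernel {N : ℕ} (G : EdgeConfig N) : Kernel (Fin N) (Fin N) :=
  Kernel.ofFunOfCountable (stepLaw G)

instance {N : ℕ} (G : EdgeConfig N) : IsMarkovKernel (stepKernel G) :=
  ⟨fun v => inferInstanceAs (IsProbabilityMeasure (stepLaw G v))⟩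

/-- The transition kernel at time `n`, as a kernel from the history `X₀, …, Xₙ` of the walk:
it depends on the present position `Xₙ` only. -/
noncomputable def historyKernel {N : ℕ} (G : EdgeConfig N) (n : ℕ) :
    Kernel (Finset.Iic n → Fin N) (Fin N) :=
  (stepKernel G).comap (fun h => h ⟨n, Finset.mem_Iic.2 le_rfl⟩) (measurable_pi_apply _)

instance {N : ℕ} (G : EdgeConfig N) (n : ℕ) : IsMarkovKernel (historyKernel G n) := by
  unfold historyKernel
  infer_instance

/-- The law, on the space of trajectories, of simple random walk `(X₀, X₁, …)` on `G`
started at `X₀ = v`. -/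
noncomputable def walkLaw {N : ℕ} (G : EdgeConfig N) (v : Fin N) : Measure (ℕ → Fin N) :=
  Kernel.trajMeasure (X := fun _ => Fin N) (Measure.dirac v) (historyKernel G)

/-- The first time `t ≥ 0` at which the trajectory `x` is at `w` (infinite if there is none). -/
noncomputable def hittingTime {N : ℕ} (w : Fin N) (x : ℕ → Fin N) : ℕ∞ :=
  hittingAfter (fun (t : ℕ) (y : ℕ → Fin N) => y t) {w} 0 x

/-- `H_{vw}`: the expected time that simple random walk started at `v` takes to reach `w`. -/
noncomputable def expectedHittingTime {N : ℕ} (G : EdgeConfig N) (v w : Fin N) : ℝ≥0∞ :=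
  ∫⁻ x, ((hittingTime w x : ℕ∞) : ℝ≥0∞) ∂(walkLaw G v)

/-- The invariant distribution `π_w = d_w / ∑ u, d_u` of simple random walk. -/
noncomputable def invariantProb {N : ℕ} (G : EdgeConfig N) (w : Fin N) : ℝ≥0∞ :=
  (degree G w : ℝ≥0∞) / ∑ u, (degree G u : ℝ≥0∞)

/-- `H^v = ∑ w, π_w H_{vw}`: the expected hitting time from `v`, averaged over the target. -/
noncomputable def targetAveragedHittingTime {N : ℕ} (G : EdgeConfig N) (v : Fin N) : ℝ≥0∞ :=
  ∑ w, invariantProb G w * expectedHittingTime G v w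

end StochasticBlockModel

/-!
For a reversible chain with a spectral gap, the hitting time averaged over a stationary target does
not depend on the starting point: it is the trace of the Green matrix `G`. Iterating
`G = 1 - Π + P G`, where all rows of `Π` are the stationary distribution, gives
`tr G = N - 2 + tr P + tr (P G P)`, and the gap bounds the last term by the diagonal of `P ^ 2`,
hence by the reciprocal of the minimal degree. So `H^v = N (1 + o(1))` as soon as the degrees are
large compared with the inverse gap.

A Chernoff bound for each star and each cut shows that, with high probability, all degrees are of
order `d`, their common mean, and every cut has density of order `r`, where `r = q` for several
blocks and `r = p` for a single one. By Cheeger's inequality the gap is then of order at least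
`(r N / d) ^ 2`, and the two hypotheses on `p` and `q` give `log N = o(d)`, `log N = o(r N)` and
`d = o((r N) ^ 2)`.
-/

section MarkovChain

variable {X : Type*}

/-- The trajectories that stay outside `S` up to time `n`. -/
def avoiding (S : Set X) (n : ℕ) : Set (ℕ → X) := {x | ∀ i ≤ n, x i ∉ S}

/-- The first time `t ≥ 0` at which a trajectory is in `S`. -/
noncomputable def entranceTime (S : Set X) (x : ℕ → X) : ℕ∞ :=
  hittingAfter (fun (t : ℕ) (y : ℕ → X) => y t) S 0 x

lemma mem_avoiding_succ {S : Set X} {n : ℕ} {x : ℕ → X} :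
    x ∈ avoiding S (n + 1) ↔ x ∈ avoiding S n ∧ x (n + 1) ∉ S := by
  simp only [avoiding, Set.mem_ofPred_eq, Nat.le_add_one_iff, or_imp, forall_and, forall_eq]

lemma natCast_lt_entranceTime_iff {S : Set X} {n : ℕ} {x : ℕ → X} :
    (n : ℕ∞) < entranceTime S x ↔ x ∈ avoiding S n := by
  have h := hittingAfter_le_iff (u := fun (t : ℕ) (y : ℕ → X) => y t) (s := S) (n := 0) (i := n)
    (ω := x)
  rw [← not_le, entranceTime]
  exact h.not.trans (by simp [avoiding])

lemma toENNReal_eq_tsum_ite_lt (T : ℕ∞) :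
    (T : ℝ≥0∞) = ∑' n : ℕ, if (n : ℕ∞) < T then 1 else 0 := by
  induction T using ENat.recTopCoe with
  | top => simp
  | coe k =>
    rw [tsum_eq_sum (s := Finset.range k) (by simp)]
    simp [Finset.filter_true_of_mem]

variable [MeasurableSpace X]

/-- The law, on the space of trajectories, of the Markov chain with transition kernel `κ` started
at `v`. -/
noncomputable def chainLaw (κ : Kernel X X) [IsMarkovKernel κ] (v : X) : Measure (ℕ → X) :=
  Kernel.trajMeasure (X := fun _ => X) (Measure.dirac v) fun n =>
    κ.comap (fun x => x ⟨n, Finset.mem_Iic.2 le_rfl⟩) (measurable_pi_apply _)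

instance (κ : Kernel X X) [IsMarkovKernel κ] (v : X) : IsProbabilityMeasure (chainLaw κ v) := by
  unfold chainLaw; infer_instance

lemma measurableSet_avoiding {S : Set X} (hS : MeasurableSet S) (n : ℕ) :
    MeasurableSet (avoiding S n) := by
  have : avoiding S n = ⋂ i ≤ n, (fun x : ℕ → X => x i) ⁻¹' Sᶜ := by
    ext x; simp [avoiding]
  rw [this]
  exact .biInter (Set.to_countable _) fun i _ => measurable_pi_apply i hS.compl

lemma lintegral_entranceTime_eq_tsum (μ : Measure (ℕ → X)) {S : Set X} (hS : MeasurableSet S) :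
    ∫⁻ x, (entranceTime S x : ℝ≥0∞) ∂μ = ∑' n, μ (avoiding S n) := by
  have indicator_eq (x : ℕ → X) :
      (entranceTime S x : ℝ≥0∞) = ∑' n, (avoiding S n).indicator 1 x := by
    classical
    simp only [toENNReal_eq_tsum_ite_lt, natCast_lt_entranceTime_iff, Set.indicator_apply,
      Pi.one_apply]
  simp_rw [indicator_eq]
  rw [lintegral_tsum fun n =>
    (measurable_one.indicator (measurableSet_avoiding hS n)).aemeasurable]
  exact tsum_congr fun n => lintegral_indicator_one (measurableSet_avoiding hS n)

lemma setLIntegral_avoiding_succ_eval_succ (μ : Measure (ℕ → X)) {S : Set X}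
    (hS : MeasurableSet S) (n : ℕ) {f : X → ℝ≥0∞} (hf : ∀ u ∈ S, f u = 0) :
    ∫⁻ x in avoiding S (n + 1), f (x (n + 1)) ∂μ = ∫⁻ x in avoiding S n, f (x (n + 1)) ∂μ := by
  classical
  simp only [← lintegral_indicator (measurableSet_avoiding hS _), Set.indicator_apply,
    mem_avoiding_succ]
  refine lintegral_congr fun x => ?_
  by_cases hx : x (n + 1) ∈ S <;> simp [hx, hf]

variable {κ : Kernel X X} [IsMarkovKernel κ]

lemma lintegral_eval_zero_chainLaw (v : X) {f : X → ℝ≥0∞} (hf : Measurable f) :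
    ∫⁻ x, f (x 0) ∂(chainLaw κ v) = f v := by
  have initial : (chainLaw κ v).map (fun x => x 0) = Measure.dirac v := by
    have eval_zero : (fun x : ℕ → X => x 0) =
        (fun y : (i : Finset.Iic 0) → X => y ⟨0, by simp⟩) ∘
          Preorder.frestrictLe (π := fun _ => X) 0 := rfl
    rw [eval_zero, ← Measure.map_map (measurable_pi_apply _) (by fun_prop), chainLaw,
      Kernel.trajMeasure, Measure.map_comp _ _ (by fun_prop), Kernel.traj_map_frestrictLe,
      Kernel.partialTraj_self, Measure.id_comp,
      Measure.map_map (measurable_pi_apply _) (by fun_prop), Measure.map_dirac' (by fun_prop)]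
    rfl
  rw [← lintegral_map hf (measurable_pi_apply 0), initial, lintegral_dirac' _ hf]

lemma setLIntegral_avoiding_eval_succ (v : X) {S : Set X} (hS : MeasurableSet S) (n : ℕ)
    {f : X → ℝ≥0∞} (hf : Measurable f) :
    ∫⁻ x in avoiding S n, f (x (n + 1)) ∂(chainLaw κ v) =
      ∫⁻ x in avoiding S n, ∫⁻ y, f y ∂(κ (x n)) ∂(chainLaw κ v) := by
  let past : Set ((i : Finset.Iic n) → X) := {y | ∀ i, y i ∉ S}
  have past_measurable : MeasurableSet past := by
    have : past = ⋂ i, (fun y => y i) ⁻¹' Sᶜ := by ext; simp [past]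
    rw [this]
    exact .iInter fun i => measurable_pi_apply i hS.compl
  have avoiding_eq : avoiding S n = Preorder.frestrictLe (π := fun _ => X) n ⁻¹' past := by
    ext x; simp [past, avoiding]
  let F : ((i : Finset.Iic n) → X) × X → ℝ≥0∞ := fun z => past.indicator (fun _ => f z.2) z.1
  have hF : Measurable F :=
    (hf.comp measurable_snd).indicator (measurable_fst past_measurable)
  have markov := congrArg (fun ν => ∫⁻ z, F z ∂ν)
    (Kernel.map_frestrictLe_trajMeasure_compProd_eq_map_trajMeasure (X := fun _ => X)
      (μ₀ := Measure.dirac v) (a := n) (κ := fun n => κ.comap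
        (fun x => x ⟨n, Finset.mem_Iic.2 le_rfl⟩) (measurable_pi_apply _)))
  beta_reduce at markov
  rw [Measure.lintegral_compProd hF, lintegral_map hF (by fun_prop),
    lintegral_map hF.lintegral_kernel_prod_right' (by fun_prop)] at markov
  rw [← lintegral_indicator (measurableSet_avoiding hS n),
    ← lintegral_indicator (measurableSet_avoiding hS n), avoiding_eq]
  refine markov.symm.trans (lintegral_congr fun x => ?_)
  by_cases hx : Preorder.frestrictLe (π := fun _ => X) n x ∈ past <;> simp [F, hx]

theorem lintegral_entranceTime_chainLaw {S : Set X} (hS : MeasurableSet S) {h : X → ℝ≥0∞}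
    (h_meas : Measurable h) {C : ℝ≥0∞} (hC : C ≠ ∞) (h_le : ∀ u, h u ≤ C)
    (h_zero : ∀ u ∈ S, h u = 0) (h_step : ∀ u ∉ S, h u = 1 + ∫⁻ y, h y ∂(κ u)) (v : X) :
    ∫⁻ x, (entranceTime S x : ℝ≥0∞) ∂(chainLaw κ v) = h v := by
  set a : ℕ → ℝ≥0∞ := fun n => chainLaw κ v (avoiding S n)
  set b : ℕ → ℝ≥0∞ := fun n => ∫⁻ x in avoiding S n, h (x n) ∂(chainLaw κ v)
  have b_zero : b 0 = h v := by
    rw [← lintegral_eval_zero_chainLaw (κ := κ) v h_meas]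
    refine setLIntegral_eq_of_support_subset fun x hx => ?_
    simpa [avoiding] using fun hS => hx (h_zero _ hS)
  have b_step (n : ℕ) : b n = a n + b (n + 1) := by
    simp only [a, b, setLIntegral_avoiding_succ_eval_succ _ hS n h_zero,
      setLIntegral_avoiding_eval_succ v hS n h_meas]
    rw [← setLIntegral_one, ← lintegral_add_left measurable_const]
    exact setLIntegral_congr_fun (measurableSet_avoiding hS n)
      fun x hx => h_step _ (hx n le_rfl)
  have h_eq (n : ℕ) : h v = ∑ i ∈ Finset.range n, a i + b n := by
    induction n with
    | zero => simp [b_zero]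
    | succ n ih => rw [Finset.sum_range_succ, ih, b_step n, add_assoc]
  have b_le (n : ℕ) : b n ≤ C * a n :=
    (setLIntegral_mono measurable_const fun x _ => h_le (x n)).trans_eq (setLIntegral_const _ _)
  have sum_ne_top : ∑' n, a n ≠ ∞ := by
    refine ne_top_of_le_ne_top (ne_top_of_le_ne_top hC (h_le v)) ?_
    rw [ENNReal.tsum_eq_iSup_nat]
    exact iSup_le fun n => (h_eq n).symm ▸ le_self_add
  have a_tendsto := ENNReal.tendsto_atTop_zero_of_tsum_ne_top sum_ne_top
  have b_tendsto : Tendsto b atTop (𝓝 0) :=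
    tendsto_of_tendsto_of_tendsto_of_le_of_le tendsto_const_nhds
      (by simpa using ENNReal.Tendsto.const_mul a_tendsto (.inr hC)) (fun _ => zero_le) b_le
  have limit := (ENNReal.tendsto_nat_tsum a).add b_tendsto
  simp only [← h_eq, add_zero] at limit
  rw [lintegral_entranceTime_eq_tsum _ hS, tendsto_nhds_unique limit tendsto_const_nhds]

end MarkovChain

section ReversibleChain

open Matrix

variable {V : Type*} [Fintype V]

/-- The Poincaré inequality with constant `γ`: the Dirichlet form `⟨f, (1 - P) f⟩` in `L²(π)`
dominates `γ` times the variance. -/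
def HasSpectralGap (P : Matrix V V ℝ) (π : V → ℝ) (γ : ℝ) : Prop :=
  ∀ f : V → ℝ, π ⬝ᵥ f = 0 → γ * π ⬝ᵥ (f * f) ≤ π ⬝ᵥ (f * (f - P *ᵥ f))

variable [DecidableEq V] {P : Matrix V V ℝ} {π : V → ℝ} {γ : ℝ}

/-- `P` is the transition matrix of a Markov chain that is reversible with respect to the
probability vector `π`, which charges every state. -/
structure IsReversibleChain (P : Matrix V V ℝ) (π : V → ℝ) : Prop where
  stochastic : P ∈ rowStochastic ℝ V
  pos : ∀ v, 0 < π v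
  sum_eq_one : ∑ v, π v = 1
  detailed_balance : ∀ v w, π v * P v w = π w * P w v

/-- The Green matrix `∑ₙ (Pⁿ - Π)` of a chain whose stationary projection `Π` has all rows equal
to `π`. The series need not converge when the chain is periodic, so the matrix is defined through
the fundamental matrix `(1 - P + Π)⁻¹` of Kemeny and Snell. -/
noncomputable def greenMatrix (P : Matrix V V ℝ) (π : V → ℝ) : Matrix V V ℝ :=
  (1 - P + replicateRow V π)⁻¹ - replicateRow V π

namespace IsReversibleChain

lemma nonneg (h : IsReversibleChain P π) (v w : V) : 0 ≤ P v w :=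
  nonneg_of_mem_rowStochastic h.stochastic

lemma sum_row (h : IsReversibleChain P π) (v : V) : ∑ w, P v w = 1 :=
  sum_row_of_mem_rowStochastic h.stochastic v

lemma dotProduct_mul_self_nonneg (h : IsReversibleChain P π) (f : V → ℝ) : 0 ≤ π ⬝ᵥ (f * f) :=
  Finset.sum_nonneg fun v _ => mul_nonneg (h.pos v).le (mul_self_nonneg _)

lemma dotProduct_const (h : IsReversibleChain P π) (c : ℝ) : π ⬝ᵥ Function.const V c = c := by
  simp [dotProduct, ← Finset.sum_mul, h.sum_eq_one]

lemma vecMul_eq (h : IsReversibleChain P π) : π ᵥ* P = π := by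
  ext w
  simp only [vecMul, dotProduct, h.detailed_balance _ w, ← Finset.mul_sum, h.sum_row, mul_one]

lemma dotProduct_mulVec_eq (h : IsReversibleChain P π) (f : V → ℝ) : π ⬝ᵥ P *ᵥ f = π ⬝ᵥ f := by
  rw [dotProduct_mulVec, h.vecMul_eq]

lemma replicateRow_mul (h : IsReversibleChain P π) :
    replicateRow V π * P = replicateRow V π := by
  rw [← replicateRow_vecMul, h.vecMul_eq]

lemma mul_replicateRow (h : IsReversibleChain P π) :
    P * replicateRow V π = replicateRow V π := by
  ext v w
  simp [mul_apply, ← Finset.sum_mul, h.sum_row]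

lemma replicateRow_mul_self (h : IsReversibleChain P π) :
    replicateRow V π * replicateRow V π = replicateRow V π := by
  ext v w
  simp [mul_apply, ← Finset.sum_mul, h.sum_eq_one]

lemma isUnit_one_sub_add (h : IsReversibleChain P π) (hγ : 0 < γ) (hgap : HasSpectralGap P π γ) :
    IsUnit (1 - P + replicateRow V π) := by
  rw [← mulVec_injective_iff_isUnit]
  refine (injective_iff_map_eq_zero (mulVecLin (1 - P + replicateRow V π))).2 fun f hf => ?_
  replace hf : f - P *ᵥ f + Function.const V (π ⬝ᵥ f) = 0 := by
    simpa [add_mulVec, sub_mulVec, replicateRow_mulVec_eq_const] using hf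
  have mean_zero : π ⬝ᵥ f = 0 := by
    simpa [dotProduct_add, dotProduct_sub, h.dotProduct_mulVec_eq, h.dotProduct_const]
      using congrArg (π ⬝ᵥ ·) hf
  have harmonic : f - P *ᵥ f = 0 := by
    simpa [mean_zero] using hf
  have sq_zero : π ⬝ᵥ (f * f) = 0 := by
    refine le_antisymm ?_ (h.dotProduct_mul_self_nonneg f)
    have := hgap f mean_zero
    rw [harmonic, mul_zero, dotProduct_zero] at this
    exact nonpos_of_mul_nonpos_right this hγ
  ext v
  have := (Finset.sum_eq_zero_iff_of_nonneg fun v _ =>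
    mul_nonneg (h.pos v).le (mul_self_nonneg (f v))).1 sq_zero v (Finset.mem_univ v)
  simpa [(h.pos v).ne'] using this

section Green

variable (h : IsReversibleChain P π) (hγ : 0 < γ) (hgap : HasSpectralGap P π γ)
include h hγ hgap

lemma vecMul_greenMatrix : π ᵥ* greenMatrix P π = 0 := by
  have replicateRow_fix : π ᵥ* replicateRow V π = π := by
    ext w
    simp [vecMul, dotProduct, ← Finset.sum_mul, h.sum_eq_one]
  have fundamental_fix : π ᵥ* (1 - P + replicateRow V π) = π := by
    rw [vecMul_add, vecMul_sub, vecMul_one, h.vecMul_eq, replicateRow_fix, sub_self, zero_add]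
  have : Invertible (1 - P + replicateRow V π) := (h.isUnit_one_sub_add hγ hgap).invertible
  rw [greenMatrix, vecMul_sub, replicateRow_fix, sub_eq_zero]
  nth_rw 1 [← fundamental_fix]
  rw [vecMul_vecMul, mul_inv_of_invertible, vecMul_one]

lemma greenMatrix_mul_replicateRow : greenMatrix P π * replicateRow V π = 0 := by
  have absorb : (1 - P + replicateRow V π) * replicateRow V π = replicateRow V π := by
    rw [add_mul, sub_mul, one_mul, h.mul_replicateRow, h.replicateRow_mul_self, sub_self, zero_add]
  have : Invertible (1 - P + replicateRow V π) := (h.isUnit_one_sub_add hγ hgap).invertible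
  rw [greenMatrix, sub_mul, h.replicateRow_mul_self, sub_eq_zero]
  nth_rw 2 [← absorb]
  exact inv_mul_cancel_left_of_invertible _ _

lemma one_sub_mul_greenMatrix : (1 - P) * greenMatrix P π = 1 - replicateRow V π := by
  have : Invertible (1 - P + replicateRow V π) := (h.isUnit_one_sub_add hγ hgap).invertible
  calc (1 - P) * greenMatrix P π
      = (1 - P + replicateRow V π) * greenMatrix P π := by
        rw [add_mul, ← replicateRow_vecMul, h.vecMul_greenMatrix hγ hgap, replicateRow_zero,
          add_zero]
    _ = 1 - replicateRow V π := by
        rw [greenMatrix, mul_sub, mul_inv_of_invertible, add_mul, sub_mul, one_mul,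
          h.mul_replicateRow, h.replicateRow_mul_self, sub_self, zero_add]

lemma greenMatrix_mul_one_sub : greenMatrix P π * (1 - P) = 1 - replicateRow V π := by
  have : Invertible (1 - P + replicateRow V π) := (h.isUnit_one_sub_add hγ hgap).invertible
  calc greenMatrix P π * (1 - P)
      = greenMatrix P π * (1 - P + replicateRow V π) := by
        rw [mul_add, h.greenMatrix_mul_replicateRow hγ hgap, add_zero]
    _ = 1 - replicateRow V π := by
        rw [greenMatrix, sub_mul, inv_mul_of_invertible, mul_add, mul_sub, mul_one,
          h.replicateRow_mul, h.replicateRow_mul_self, sub_self, zero_add]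

lemma greenMatrix_eq_add : greenMatrix P π =
    1 - replicateRow V π + (P - replicateRow V π) + P * greenMatrix P π * P := by
  have left : greenMatrix P π = 1 - replicateRow V π + P * greenMatrix P π := by
    rw [← h.one_sub_mul_greenMatrix hγ hgap]; noncomm_ring
  have right : greenMatrix P π = 1 - replicateRow V π + greenMatrix P π * P := by
    rw [← h.greenMatrix_mul_one_sub hγ hgap]; noncomm_ring
  nth_rw 1 [left, right]
  rw [mul_add, mul_sub, mul_one, h.mul_replicateRow, mul_assoc, add_assoc]

lemma sum_greenMatrix (v : V) : ∑ w, greenMatrix P π v w = 0 := by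
  have : Nonempty V := ⟨v⟩
  have := congrFun₂ (h.greenMatrix_mul_replicateRow hγ hgap) v v
  simpa [mul_apply, ← Finset.sum_mul, (h.pos v).ne'] using this

lemma dotProduct_mul_greenMatrix (f : V → ℝ) :
    0 ≤ π ⬝ᵥ (f * greenMatrix P π *ᵥ f) ∧
      γ * π ⬝ᵥ (f * greenMatrix P π *ᵥ f) ≤ π ⬝ᵥ (f * f) := by
  set k := greenMatrix P π *ᵥ f
  have k_mean : π ⬝ᵥ k = 0 := by
    rw [dotProduct_mulVec, h.vecMul_greenMatrix hγ hgap, zero_dotProduct]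
  have k_eq : k - P *ᵥ k = f - Function.const V (π ⬝ᵥ f) := by
    simpa [sub_mul, sub_mulVec, mulVec_mulVec, replicateRow_mulVec_eq_const, k]
      using congrArg (· *ᵥ f) (h.one_sub_mul_greenMatrix hγ hgap)
  have energy : π ⬝ᵥ (k * (k - P *ᵥ k)) = π ⬝ᵥ (f * k) := by
    have : k * (k - P *ᵥ k) = f * k - (π ⬝ᵥ f) • k := by
      rw [k_eq]; ext v; simp; ring
    rw [this, dotProduct_sub, dotProduct_smul, k_mean, smul_zero, sub_zero]
  have gap : γ * π ⬝ᵥ (k * k) ≤ π ⬝ᵥ (f * k) := energy ▸ hgap k k_mean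
  have square : 0 ≤ π ⬝ᵥ ((γ • k - f) * (γ • k - f)) := h.dotProduct_mul_self_nonneg _
  have expand : π ⬝ᵥ ((γ • k - f) * (γ • k - f)) =
      γ * (γ * π ⬝ᵥ (k * k)) - 2 * (γ * π ⬝ᵥ (f * k)) + π ⬝ᵥ (f * f) := by
    simp only [dotProduct, Pi.mul_apply, Pi.sub_apply, Pi.smul_apply, smul_eq_mul, Finset.mul_sum,
      ← Finset.sum_sub_distrib, ← Finset.sum_add_distrib]
    exact Finset.sum_congr rfl fun v _ => by ring
  constructor
  · exact (mul_nonneg hγ.le (h.dotProduct_mul_self_nonneg k)).trans gap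
  · nlinarith

lemma mul_greenMatrix_mul_diag (w : V) :
    0 ≤ (P * greenMatrix P π * P) w w ∧
      γ * (P * greenMatrix P π * P) w w ≤ (P * P) w w := by
  have diag (M : Matrix V V ℝ) : π ⬝ᵥ (P.col w * M *ᵥ P.col w) = π w * (P * M * P) w w := by
    rw [mul_assoc, mul_apply, Finset.mul_sum]
    refine Finset.sum_congr rfl fun v _ => ?_
    rw [← mul_assoc, ← h.detailed_balance, mul_assoc]
    rfl
  have diag_one := diag 1
  rw [one_mulVec, mul_one] at diag_one
  obtain ⟨lower, upper⟩ := h.dotProduct_mul_greenMatrix hγ hgap (P.col w)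
  rw [diag] at lower upper
  rw [diag_one, mul_left_comm] at upper
  exact ⟨nonneg_of_mul_nonneg_right lower (h.pos w), le_of_mul_le_mul_left upper (h.pos w)⟩

theorem trace_greenMatrix_eq : (greenMatrix P π).trace =
    Fintype.card V - 2 + P.trace + (P * greenMatrix P π * P).trace := by
  have trace_row : (replicateRow V π).trace = 1 := h.sum_eq_one
  conv_lhs => rw [h.greenMatrix_eq_add hγ hgap]
  simp only [trace_add, trace_sub, trace_one, trace_row]
  ring

theorem card_sub_two_le_trace_greenMatrix : Fintype.card V - 2 ≤ (greenMatrix P π).trace := by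
  have : 0 ≤ P.trace := Finset.sum_nonneg fun v _ => h.nonneg v v
  have : 0 ≤ (P * greenMatrix P π * P).trace :=
    Finset.sum_nonneg fun v _ => (h.mul_greenMatrix_mul_diag hγ hgap v).1
  rw [h.trace_greenMatrix_eq hγ hgap]
  linarith

theorem trace_greenMatrix_le {η : ℝ} (hη : ∀ v w, P v w ≤ η) :
    (greenMatrix P π).trace ≤ Fintype.card V * (1 + η + η / γ) := by
  have diag_sq_le (v : V) : (P * P) v v ≤ η := by
    calc (P * P) v v = ∑ w, P v w * P w v := mul_apply
      _ ≤ ∑ w, P v w * η := Finset.sum_le_sum fun w _ =>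
          mul_le_mul_of_nonneg_left (hη w v) (h.nonneg v w)
      _ = η := by rw [← Finset.sum_mul, h.sum_row, one_mul]
  have diag_le (v : V) : (P * greenMatrix P π * P) v v ≤ η / γ :=
    (le_div_iff₀' hγ).2 <| (h.mul_greenMatrix_mul_diag hγ hgap v).2.trans (diag_sq_le v)
  have : P.trace ≤ Fintype.card V * η := by
    simpa [trace] using Finset.sum_le_card_nsmul Finset.univ _ _ fun v _ => hη v v
  have : (P * greenMatrix P π * P).trace ≤ Fintype.card V * (η / γ) := by
    simpa [trace] using Finset.sum_le_card_nsmul Finset.univ _ _ fun v _ => diag_le v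
  rw [h.trace_greenMatrix_eq hγ hgap]
  linarith

end Green

end IsReversibleChain

end ReversibleChain

section RandomTarget

open Matrix

variable {V : Type*} [Fintype V]

/-- The matrix of transition probabilities of a Markov kernel on a finite state space. -/
noncomputable def transitionMatrix [MeasurableSpace V] (κ : Kernel V V) : Matrix V V ℝ :=
  .of fun v w => (κ v).real {w}

variable [DecidableEq V]

/-- The expected time a reversible chain with transition matrix `P` takes to reach `w` from `v`,
in terms of its Green matrix; see `lintegral_entranceTime_eq_meanEntranceTime`. -/
noncomputable def meanEntranceTime (P : Matrix V V ℝ) (π : V → ℝ) (w v : V) : ℝ :=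
  (greenMatrix P π w w - greenMatrix P π v w) / π w

namespace IsReversibleChain

variable {P : Matrix V V ℝ} {π : V → ℝ} {γ : ℝ} (h : IsReversibleChain P π) (hγ : 0 < γ)
  (hgap : HasSpectralGap P π γ)
include h hγ hgap

lemma meanEntranceTime_step {v w : V} (hvw : v ≠ w) :
    meanEntranceTime P π w v = 1 + (P *ᵥ meanEntranceTime P π w) v := by
  have green_step : greenMatrix P π v w - ∑ u, P v u * greenMatrix P π u w = - π w := by
    have := congrFun₂ (h.one_sub_mul_greenMatrix hγ hgap) v w
    simpa [sub_mul, mul_apply, one_apply, hvw] using this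
  have average : (P *ᵥ meanEntranceTime P π w) v =
      (greenMatrix P π w w - ∑ u, P v u * greenMatrix P π u w) / π w := by
    simp only [mulVec, dotProduct, meanEntranceTime, mul_div, mul_sub, ← Finset.sum_div,
      Finset.sum_sub_distrib, ← Finset.sum_mul, h.sum_row, one_mul]
  have := (h.pos w).ne'
  rw [average, meanEntranceTime]
  field_simp
  linarith

/-- By the minimum principle: a minimum outside `w` would exceed its own average over a step. -/
lemma meanEntranceTime_nonneg (v w : V) : 0 ≤ meanEntranceTime P π w v := by
  have : Nonempty V := ⟨v⟩
  obtain ⟨u, hu⟩ := Finite.exists_min (meanEntranceTime P π w)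
  suffices u = w by simpa [meanEntranceTime, this] using hu v
  by_contra huw
  have average_ge : meanEntranceTime P π w u ≤ (P *ᵥ meanEntranceTime P π w) u := by
    calc meanEntranceTime P π w u = ∑ x, P u x * meanEntranceTime P π w u := by
          rw [← Finset.sum_mul, h.sum_row, one_mul]
      _ ≤ ∑ x, P u x * meanEntranceTime P π w x :=
          Finset.sum_le_sum fun x _ => mul_le_mul_of_nonneg_left (hu x) (h.nonneg u x)
  linarith [h.meanEntranceTime_step hγ hgap huw]

lemma sum_mul_meanEntranceTime (v : V) :
    ∑ w, π w * meanEntranceTime P π w v = (greenMatrix P π).trace := by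
  have (w : V) : π w * meanEntranceTime P π w v = greenMatrix P π w w - greenMatrix P π v w :=
    mul_div_cancel₀ _ (h.pos w).ne'
  simp only [this, Finset.sum_sub_distrib, h.sum_greenMatrix hγ hgap, sub_zero]
  rfl

end IsReversibleChain

variable [MeasurableSpace V] [MeasurableSingletonClass V] {κ : Kernel V V} [IsMarkovKernel κ]
  {π : V → ℝ} {γ : ℝ}

omit [DecidableEq V] in
lemma lintegral_ofReal_eq_transitionMatrix_mulVec {f : V → ℝ} (hf : ∀ v, 0 ≤ f v) (v : V) :
    ∫⁻ u, ENNReal.ofReal (f u) ∂(κ v) = ENNReal.ofReal ((transitionMatrix κ *ᵥ f) v) := by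
  have average : (transitionMatrix κ *ᵥ f) v = ∑ u, (κ v).real {u} * f u := rfl
  rw [lintegral_fintype, average,
    ENNReal.ofReal_sum_of_nonneg fun u _ => mul_nonneg measureReal_nonneg (hf u)]
  refine Finset.sum_congr rfl fun u _ => ?_
  rw [mul_comm, ENNReal.ofReal_mul measureReal_nonneg, ofReal_measureReal]

variable (h : IsReversibleChain (transitionMatrix κ) π) (hγ : 0 < γ)
  (hgap : HasSpectralGap (transitionMatrix κ) π γ)
include h hγ hgap

lemma lintegral_entranceTime_eq_meanEntranceTime (v w : V) :
    ∫⁻ x, (entranceTime {w} x : ℝ≥0∞) ∂(chainLaw κ v) =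
      ENNReal.ofReal (meanEntranceTime (transitionMatrix κ) π w v) := by
  set m := meanEntranceTime (transitionMatrix κ) π w
  have m_nonneg (u : V) : 0 ≤ m u := h.meanEntranceTime_nonneg hγ hgap u w
  refine lintegral_entranceTime_chainLaw (h := fun u => ENNReal.ofReal (m u))
    (C := ∑ u, ENNReal.ofReal (m u)) (measurableSet_singleton w) .of_discrete
    (ENNReal.sum_ne_top.2 fun _ _ => ENNReal.ofReal_ne_top)
    (fun u => Finset.single_le_sum (f := fun u => ENNReal.ofReal (m u)) (fun _ _ => zero_le)
      (Finset.mem_univ u)) ?_ ?_ v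
  · simp [m, meanEntranceTime]
  · intro u hu
    have average_nonneg : 0 ≤ (transitionMatrix κ *ᵥ m) u :=
      Finset.sum_nonneg fun x _ => mul_nonneg (h.nonneg u x) (m_nonneg x)
    rw [lintegral_ofReal_eq_transitionMatrix_mulVec m_nonneg, ← ENNReal.ofReal_one,
      ← ENNReal.ofReal_add zero_le_one average_nonneg, ← h.meanEntranceTime_step hγ hgap hu]

theorem sum_mul_lintegral_entranceTime (v : V) :
    ∑ w, ENNReal.ofReal (π w) * ∫⁻ x, (entranceTime {w} x : ℝ≥0∞) ∂(chainLaw κ v) =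
      ENNReal.ofReal (greenMatrix (transitionMatrix κ) π).trace := by
  simp_rw [lintegral_entranceTime_eq_meanEntranceTime h hγ hgap,
    ← ENNReal.ofReal_mul (h.pos _).le]
  rw [← ENNReal.ofReal_sum_of_nonneg, h.sum_mul_meanEntranceTime hγ hgap]
  exact fun w _ => mul_nonneg (h.pos w).le (h.meanEntranceTime_nonneg hγ hgap v w)

end RandomTarget

section Cheeger

open Matrix

lemma half_sq_sub_le_abs (a b : ℝ) : (a - b) ^ 2 / 2 ≤ |a * (|a|) - b * (|b|)| := by
  wlog h : b ≤ a
  · rw [abs_sub_comm, ← neg_sub, neg_sq]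
    exact this b a (le_of_not_ge h)
  refine le_trans ?_ (le_abs_self _)
  rcases abs_cases a with ⟨ha, _⟩ | ⟨ha, _⟩ <;>
    rcases abs_cases b with ⟨hb, _⟩ | ⟨hb, _⟩ <;>
    rw [ha, hb] <;> nlinarith [sq_nonneg (a + b)]

lemma abs_mul_abs_sub_le (a b : ℝ) : |a * (|a|) - b * (|b|)| ≤ |a - b| * (|a| + |b|) := by
  calc |a * (|a|) - b * (|b|)| = |(a - b) * (|a|) + b * (|a| - (|b|))| := by ring_nf
    _ ≤ |(a - b) * (|a|)| + |b * (|a| - (|b|))| := abs_add_le _ _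
    _ ≤ |a - b| * |a| + |b| * |a - b| := by
        rw [abs_mul, abs_mul, abs_abs]
        exact add_le_add_right
          (mul_le_mul_of_nonneg_left (abs_abs_sub_abs_le_abs_sub a b) (abs_nonneg b)) _
    _ = |a - b| * (|a| + |b|) := by ring

variable {V : Type*} [Fintype V] [DecidableEq V]

/-- The layer-cake formula reduces the claim to the superlevel sets `{v | t ≤ g v}`. -/
lemma sum_mul_max_sub_nonneg {c : V → V → ℝ}
    (hc : ∀ S : Finset V, 0 ≤ ∑ v ∈ S, ∑ w ∈ Sᶜ, c v w) (g : V → ℝ) :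
    0 ≤ ∑ v, ∑ w, c v w * max (g v - g w) 0 := by
  have integrable (v w : V) :
      Integrable (fun t => c v w * (Set.Ioc (g w) (g v)).indicator 1 t) :=
    ((integrable_indicator_iff measurableSet_Ioc).2
      (integrableOn_const (C := (1 : ℝ)) (by simp))).const_mul _
  have layer_cake : ∑ v, ∑ w, c v w * max (g v - g w) 0 =
      ∫ t, ∑ v, ∑ w, c v w * (Set.Ioc (g w) (g v)).indicator 1 t := by
    simp only [integral_finsetSum _ fun v _ => integrable_finsetSum _ fun w _ => integrable v w,
      integral_finsetSum _ fun w _ => integrable _ w, integral_const_mul,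
      integral_indicator_one measurableSet_Ioc, Real.volume_real_Ioc]
  rw [layer_cake]
  refine integral_nonneg fun t => (hc {v | t ≤ g v}).trans_eq ?_
  simp only [Finset.sum_filter, Finset.compl_filter, Set.indicator_apply, Set.mem_Ioc, not_le]
  refine Finset.sum_congr rfl fun v _ => ?_
  by_cases hv : t ≤ g v <;> simp [hv]

lemma sum_mul_abs_sub_nonneg {c : V → V → ℝ}
    (hc : ∀ S : Finset V, 0 ≤ ∑ v ∈ S, ∑ w ∈ Sᶜ, c v w) (g : V → ℝ) :
    0 ≤ ∑ v, ∑ w, c v w * |g v - g w| := by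
  have split (v w : V) :
      c v w * |g v - g w| = c v w * max (g v - g w) 0 + c v w * max (-g v - -g w) 0 := by
    rw [← mul_add, neg_sub_neg, ← neg_sub (g v) (g w), max_zero_add_max_neg_zero_eq_abs_self]
  simp only [split, Finset.sum_add_distrib]
  exact add_nonneg (sum_mul_max_sub_nonneg hc g) (sum_mul_max_sub_nonneg hc fun v => -g v)

/-- The stationary flow out of every set `S` is at least `φ` times `π(S) π(Sᶜ)`. -/
def HasConductance (P : Matrix V V ℝ) (π : V → ℝ) (φ : ℝ) : Prop :=
  ∀ S : Finset V, φ * ((∑ v ∈ S, π v) * ∑ w ∈ Sᶜ, π w) ≤ ∑ v ∈ S, ∑ w ∈ Sᶜ, π v * P v w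

namespace IsReversibleChain

variable {P : Matrix V V ℝ} {π : V → ℝ} {φ : ℝ} (h : IsReversibleChain P π)
include h

lemma sum_flow_mul_left (f : V → ℝ) : ∑ v, ∑ w, π v * P v w * f v = π ⬝ᵥ f := by
  simp only [mul_right_comm _ (P _ _), ← Finset.mul_sum, h.sum_row, mul_one, dotProduct]

lemma sum_flow_mul_right (f : V → ℝ) : ∑ v, ∑ w, π v * P v w * f w = π ⬝ᵥ f := by
  rw [Finset.sum_comm, ← h.sum_flow_mul_left f]
  simp only [h.detailed_balance]

lemma sum_flow_mul_sq_sub (f : V → ℝ) :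
    ∑ v, ∑ w, π v * P v w * (f v - f w) ^ 2 = 2 * π ⬝ᵥ (f * (f - P *ᵥ f)) := by
  have cross : ∑ v, ∑ w, π v * P v w * (f v * f w) = π ⬝ᵥ (f * P *ᵥ f) := by
    simp only [dotProduct, mulVec, Pi.mul_apply, Finset.mul_sum]
    exact Finset.sum_congr rfl fun v _ => Finset.sum_congr rfl fun w _ => by ring
  have left := h.sum_flow_mul_left (f * f)
  have right := h.sum_flow_mul_right (f * f)
  have expand (v w : V) : π v * P v w * (f v - f w) ^ 2 = π v * P v w * (f * f) v +
      π v * P v w * (f * f) w - 2 * (π v * P v w * (f v * f w)) := by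
    simp only [Pi.mul_apply]; ring
  simp only [expand, Finset.sum_add_distrib, Finset.sum_sub_distrib, ← Finset.mul_sum, left, right,
    cross, mul_sub, dotProduct_sub]
  ring

lemma sum_mul_sq_sub {f : V → ℝ} (hf : π ⬝ᵥ f = 0) :
    ∑ v, ∑ w, π v * π w * (f v - f w) ^ 2 = 2 * π ⬝ᵥ (f * f) := by
  have expand (v w : V) : π v * π w * (f v - f w) ^ 2 =
      π v * (f v * f v) * π w + π v * (π w * (f w * f w)) - 2 * (π v * f v * (π w * f w)) := by
    ring
  have hf : ∑ v, π v * f v = 0 := hf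
  simp only [expand, Finset.sum_add_distrib, Finset.sum_sub_distrib, ← Finset.mul_sum,
    ← Finset.sum_mul, h.sum_eq_one, hf, dotProduct, Pi.mul_apply]
  ring

lemma sum_flow_mul_sq_add_abs_le (f : V → ℝ) :
    ∑ v, ∑ w, π v * P v w * (|f v| + |f w|) ^ 2 ≤ 4 * π ⬝ᵥ (f * f) := by
  have left := h.sum_flow_mul_left (f * f)
  have right := h.sum_flow_mul_right (f * f)
  calc ∑ v, ∑ w, π v * P v w * (|f v| + |f w|) ^ 2
      ≤ ∑ v, ∑ w, (2 * (π v * P v w * (f * f) v) + 2 * (π v * P v w * (f * f) w)) := by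
        refine Finset.sum_le_sum fun v _ => Finset.sum_le_sum fun w _ => ?_
        have := mul_le_mul_of_nonneg_left (add_sq_le (a := |f v|) (b := |f w|))
          (mul_nonneg (h.pos v).le (h.nonneg v w))
        simp only [sq_abs] at this
        simp only [Pi.mul_apply]
        linarith
    _ = 4 * π ⬝ᵥ (f * f) := by
        simp only [Finset.sum_add_distrib, ← Finset.mul_sum, left, right]
        ring

lemma conductance_mul_le (hφ : 0 ≤ φ) (hcond : HasConductance P π φ) {f : V → ℝ}
    (hf : π ⬝ᵥ f = 0) :
    φ * π ⬝ᵥ (f * f) ≤ ∑ v, ∑ w, π v * P v w * (|f v - f w| * (|f v| + |f w|)) := by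
  have cut (S : Finset V) : 0 ≤ ∑ v ∈ S, ∑ w ∈ Sᶜ, (π v * P v w - φ * (π v * π w)) := by
    have := hcond S
    rw [Finset.sum_mul_sum] at this
    simpa only [Finset.sum_sub_distrib, ← Finset.mul_sum, sub_nonneg] using this
  have coarea := sum_mul_abs_sub_nonneg cut fun v => f v * |f v|
  simp only [sub_mul, Finset.sum_sub_distrib, sub_nonneg] at coarea
  have π_nonneg (v w : V) : 0 ≤ π v * π w := mul_nonneg (h.pos v).le (h.pos w).le
  have flow_nonneg (v w : V) : 0 ≤ π v * P v w := mul_nonneg (h.pos v).le (h.nonneg v w)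
  calc φ * π ⬝ᵥ (f * f)
      = ∑ v, ∑ w, φ * (π v * π w) * ((f v - f w) ^ 2 / 2) := by
        simp only [mul_assoc φ, mul_div_assoc', ← Finset.mul_sum, ← Finset.sum_div,
          h.sum_mul_sq_sub hf]
        ring
    _ ≤ ∑ v, ∑ w, φ * (π v * π w) * |f v * (|f v|) - f w * (|f w|)| := by
        gcongr with v _ w
        exacts [mul_nonneg hφ (π_nonneg v w), half_sq_sub_le_abs _ _]
    _ ≤ ∑ v, ∑ w, π v * P v w * |f v * (|f v|) - f w * (|f w|)| := coarea
    _ ≤ ∑ v, ∑ w, π v * P v w * (|f v - f w| * (|f v| + |f w|)) := by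
        gcongr with v _ w
        exacts [flow_nonneg v w, abs_mul_abs_sub_le _ _]

lemma sq_sum_flow_mul_le (f g : V → V → ℝ) :
    (∑ v, ∑ w, π v * P v w * (f v w * g v w)) ^ 2 ≤
      (∑ v, ∑ w, π v * P v w * f v w ^ 2) * ∑ v, ∑ w, π v * P v w * g v w ^ 2 := by
  simp only [← Fintype.sum_prod_type']
  exact Finset.sum_sq_le_sum_mul_sum_of_sq_le_mul _
    (fun x _ => mul_nonneg (mul_nonneg (h.pos _).le (h.nonneg _ _)) (sq_nonneg _))
    (fun x _ => mul_nonneg (mul_nonneg (h.pos _).le (h.nonneg _ _)) (sq_nonneg _))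
    fun x _ => le_of_eq (by ring)

/-- **Cheeger's inequality.** -/
theorem hasSpectralGap_of_hasConductance (hφ : 0 ≤ φ) (hcond : HasConductance P π φ) :
    HasSpectralGap P π (φ ^ 2 / 8) := by
  intro f hf
  set X := π ⬝ᵥ (f * f)
  set E := π ⬝ᵥ (f * (f - P *ᵥ f))
  have X_nonneg : 0 ≤ X := h.dotProduct_mul_self_nonneg f
  have energy := h.sum_flow_mul_sq_sub f
  have E_nonneg : 0 ≤ 2 * E := energy ▸ Finset.sum_nonneg fun v _ => Finset.sum_nonneg fun w _ =>
    mul_nonneg (mul_nonneg (h.pos v).le (h.nonneg v w)) (sq_nonneg _)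
  have cauchy_schwarz : (φ * X) ^ 2 ≤ 2 * E * (4 * X) := by
    refine (pow_le_pow_left₀ (mul_nonneg hφ X_nonneg) (h.conductance_mul_le hφ hcond hf) 2).trans <|
      (h.sq_sum_flow_mul_le (fun v w => |f v - f w|) fun v w => |f v| + |f w|).trans ?_
    simp only [sq_abs, energy]
    gcongr
    exact h.sum_flow_mul_sq_add_abs_le f
  rcases X_nonneg.eq_or_lt with X_zero | X_pos
  · rw [← X_zero, mul_zero]
    linarith
  · nlinarith

end IsReversibleChain

end Cheeger

section ChernoffBound

variable {ι : Type*} [Fintype ι] (θ : ι → unitInterval) (F : Finset ι)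

/-- The law of independent Boolean variables indexed by `ι`, of which the `e`-th is `true` with
probability `θ e`. -/
noncomputable def bernoulliProduct : Measure (ι → Bool) :=
  Measure.pi fun e => bernoulliMeasure true false (θ e)

instance : IsProbabilityMeasure (bernoulliProduct θ) := by
  unfold bernoulliProduct
  infer_instance

/-- The number of indices in `F` at which `x` is `true`. -/
def trueCount (x : ι → Bool) : ℝ := ∑ e ∈ F, ((x e).toNat : ℝ)

lemma mgf_trueCount_le (t : ℝ) :
    mgf (trueCount F) (bernoulliProduct θ) t ≤
      Real.exp ((Real.exp t - 1) * ∑ e ∈ F, (θ e : ℝ)) := by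
  classical
  have exp_trueCount (x : ι → Bool) : Real.exp (t * trueCount F x) =
      ∏ e, if e ∈ F then Real.exp (t * (x e).toNat) else 1 := by
    rw [Finset.prod_ite_mem, Finset.univ_inter, trueCount, Finset.mul_sum, Real.exp_sum]
  have factor (e : ι) : ∫ b, (if e ∈ F then Real.exp (t * b.toNat) else 1)
      ∂(bernoulliMeasure true false (θ e)) = if e ∈ F then 1 + θ e * (Real.exp t - 1) else 1 := by
    split_ifs with he
    · rw [integral_bernoulliMeasure]
      simp only [Bool.toNat_true, Bool.toNat_false, Nat.cast_one, Nat.cast_zero, mul_one, mul_zero,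
        Real.exp_zero, smul_eq_mul]
      ring
    · simp
  rw [mgf, bernoulliProduct]
  simp only [exp_trueCount]
  rw [integral_fintype_prod_eq_prod (𝕜 := ℝ) fun e (b : Bool) =>
    if e ∈ F then Real.exp (t * b.toNat) else 1]
  simp only [factor]
  rw [Finset.prod_ite_mem, Finset.univ_inter, Finset.mul_sum, Real.exp_sum]
  refine Finset.prod_le_prod (fun e _ => ?_) fun e _ => ?_
  · nlinarith [(θ e).2.1, (θ e).2.2, Real.exp_pos t]
  · rw [add_comm, mul_comm]
    exact Real.add_one_le_exp _

lemma measureReal_trueCount_le_half_le :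
    (bernoulliProduct θ).real {x | trueCount F x ≤ (∑ e ∈ F, (θ e : ℝ)) / 2} ≤
      Real.exp (-(∑ e ∈ F, (θ e : ℝ)) / 10) := by
  have mean_nonneg : 0 ≤ ∑ e ∈ F, (θ e : ℝ) := Finset.sum_nonneg fun e _ => (θ e).2.1
  have exp_neg_one_le : Real.exp (-1) ≤ 2 / 5 := Real.exp_neg_one_lt_d9.le.trans (by norm_num)
  refine (measure_le_le_exp_mul_mgf (t := -1) _ (by norm_num) .of_finite).trans ?_
  refine (mul_le_mul_of_nonneg_left (mgf_trueCount_le θ F (-1)) (Real.exp_pos _).le).trans ?_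
  rw [← Real.exp_add, Real.exp_le_exp]
  nlinarith

lemma measureReal_two_mul_le_trueCount_le :
    (bernoulliProduct θ).real {x | 2 * ∑ e ∈ F, (θ e : ℝ) ≤ trueCount F x} ≤
      Real.exp (-(∑ e ∈ F, (θ e : ℝ)) / 10) := by
  have mean_nonneg : 0 ≤ ∑ e ∈ F, (θ e : ℝ) := Finset.sum_nonneg fun e _ => (θ e).2.1
  have exp_one_le : Real.exp 1 ≤ 14 / 5 := Real.exp_one_lt_d9.le.trans (by norm_num)
  refine (measure_ge_le_exp_mul_mgf (t := 1) _ (by norm_num) .of_finite).trans ?_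
  refine (mul_le_mul_of_nonneg_left (mgf_trueCount_le θ F 1) (Real.exp_pos _).le).trans ?_
  rw [← Real.exp_add, Real.exp_le_exp]
  nlinarith

end ChernoffBound

namespace StochasticBlockModel

section RandomWalk

open Matrix

variable {N : ℕ} {G : EdgeConfig N} {d ρ : ℝ}

/-- The entry of the adjacency matrix of `G`; a loop contributes `1` to the diagonal. -/
def adjacency (G : EdgeConfig N) (v w : Fin N) : ℝ := (G s(v, w)).toNat

/-- The invariant distribution of the walk, as a real vector. -/
noncomputable def invariantVector (G : EdgeConfig N) (v : Fin N) : ℝ :=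
  degree G v / ∑ u, (degree G u : ℝ)

/-- All degrees are within a factor two of `d`, and all cuts have edge density at least `ρ`. -/
structure IsExpanding (d ρ : ℝ) (G : EdgeConfig N) : Prop where
  half_le_degree : ∀ v, d / 2 ≤ degree G v
  degree_le : ∀ v, (degree G v : ℝ) ≤ 2 * d
  le_cut : ∀ S : Finset (Fin N),
    ρ * (S.card * (Sᶜ).card) ≤ ∑ v ∈ S, ∑ w ∈ Sᶜ, adjacency G v w

lemma sum_adjacency (v : Fin N) : ∑ w, adjacency G v w = degree G v := by
  rw [degree, neighbors, Finset.card_filter, Nat.cast_sum]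
  refine Finset.sum_congr rfl fun w _ => ?_
  cases h : G s(v, w) <;> simp [adjacency, h]

lemma adjacency_comm (v w : Fin N) : adjacency G v w = adjacency G w v := by
  rw [adjacency, Sym2.eq_swap, adjacency]

lemma adjacency_le_one (v w : Fin N) : adjacency G v w ≤ 1 := by
  rw [adjacency]
  exact_mod_cast Bool.toNat_le (G s(v, w))

lemma transitionMatrix_stepKernel {v : Fin N} (hv : degree G v ≠ 0) (w : Fin N) :
    transitionMatrix (stepKernel G) v w = adjacency G v w / degree G v := by
  have nonempty : (neighbors G v).Nonempty := Finset.card_ne_zero.1 hv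
  have step : transitionMatrix (stepKernel G) v w = (stepLaw G v).real {w} := rfl
  rw [step, stepLaw, if_pos nonempty, measureReal_def, ← Finset.coe_singleton,
    uniformOn_apply_finset, degree, adjacency]
  by_cases hw : G s(v, w) = true
  · rw [Finset.inter_singleton_of_mem (by simpa [neighbors] using hw)]
    simp [hw]
  · rw [Finset.inter_singleton_of_notMem (by simpa [neighbors] using hw)]
    simp [hw]

variable (hdeg : ∀ v, degree G v ≠ 0)
include hdeg

lemma sum_degree_pos (v : Fin N) : 0 < ∑ u, (degree G u : ℝ) :=
  Finset.sum_pos (fun u _ => by exact_mod_cast (hdeg u).bot_lt) ⟨v, Finset.mem_univ v⟩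

lemma invariantProb_eq_ofReal (v : Fin N) :
    invariantProb G v = ENNReal.ofReal (invariantVector G v) := by
  rw [invariantProb, invariantVector, ENNReal.ofReal_div_of_pos (sum_degree_pos hdeg v),
    ENNReal.ofReal_sum_of_nonneg fun _ _ => Nat.cast_nonneg _]
  simp only [ENNReal.ofReal_natCast]

lemma invariantVector_mul_transitionMatrix (v w : Fin N) :
    invariantVector G v * transitionMatrix (stepKernel G) v w =
      adjacency G v w / ∑ u, (degree G u : ℝ) := by
  have : (degree G v : ℝ) ≠ 0 := by exact_mod_cast hdeg v
  rw [transitionMatrix_stepKernel (hdeg v), invariantVector]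
  field_simp

lemma isReversibleChain_stepKernel [NeZero N] :
    IsReversibleChain (transitionMatrix (stepKernel G)) (invariantVector G) where
  stochastic := by
    refine mem_rowStochastic_iff_sum.2 ⟨fun _ _ => measureReal_nonneg, fun v => ?_⟩
    have : (degree G v : ℝ) ≠ 0 := by exact_mod_cast hdeg v
    simp only [transitionMatrix_stepKernel (hdeg v), ← Finset.sum_div, sum_adjacency, div_self this]
  pos v := div_pos (by exact_mod_cast (hdeg v).bot_lt) (sum_degree_pos hdeg v)
  sum_eq_one := by
    simp only [invariantVector, ← Finset.sum_div, div_self (sum_degree_pos hdeg 0).ne']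
  detailed_balance v w := by
    rw [invariantVector_mul_transitionMatrix hdeg, invariantVector_mul_transitionMatrix hdeg,
      adjacency_comm]

omit hdeg

namespace IsExpanding

variable (hG : IsExpanding d ρ G) (hd : 0 < d)
include hG

lemma sum_invariantVector_le (S : Finset (Fin N)) :
    ∑ v ∈ S, invariantVector G v ≤ 2 * d * S.card / ∑ u, (degree G u : ℝ) := by
  simp only [invariantVector, ← Finset.sum_div]
  gcongr
  calc ∑ v ∈ S, (degree G v : ℝ) ≤ ∑ v ∈ S, 2 * d := Finset.sum_le_sum fun v _ => hG.degree_le v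
    _ = 2 * d * S.card := by simp [mul_comm]

include hd

lemma degree_ne_zero (v : Fin N) : degree G v ≠ 0 := by
  have := hG.half_le_degree v
  exact_mod_cast (by linarith : (0 : ℝ) < degree G v).ne'

lemma transitionMatrix_le (v w : Fin N) : transitionMatrix (stepKernel G) v w ≤ 2 / d := by
  have := hG.half_le_degree v
  rw [transitionMatrix_stepKernel (hG.degree_ne_zero hd v), div_le_div_iff₀ (by linarith) hd]
  nlinarith [adjacency_le_one (G := G) v w]

lemma hasConductance [NeZero N] (hρ : 0 ≤ ρ) :
    HasConductance (transitionMatrix (stepKernel G)) (invariantVector G) (ρ * N / (8 * d)) := by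
  intro S
  set W := ∑ u, (degree G u : ℝ)
  have W_pos : 0 < W := sum_degree_pos (hG.degree_ne_zero hd) 0
  have W_ge : N * (d / 2) ≤ W := by
    simpa using Finset.card_nsmul_le_sum Finset.univ (fun u => (degree G u : ℝ)) (d / 2)
      fun v _ => hG.half_le_degree v
  have invariant_nonneg (v : Fin N) : 0 ≤ invariantVector G v :=
    div_nonneg (Nat.cast_nonneg _) W_pos.le
  simp only [invariantVector_mul_transitionMatrix (hG.degree_ne_zero hd), ← Finset.sum_div]
  rw [le_div_iff₀ W_pos]
  calc ρ * N / (8 * d) * ((∑ v ∈ S, invariantVector G v) * ∑ w ∈ Sᶜ, invariantVector G w) * W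
      ≤ ρ * N / (8 * d) * (2 * d * S.card / W * (2 * d * (Sᶜ).card / W)) * W := by
        gcongr
        · exact Finset.sum_nonneg fun v _ => invariant_nonneg v
        · exact hG.sum_invariantVector_le S
        · exact hG.sum_invariantVector_le Sᶜ
    _ = ρ * (S.card * (Sᶜ).card) * (N * (d / 2) / W) := by
        field_simp
        norm_num
    _ ≤ ρ * (S.card * (Sᶜ).card) :=
        mul_le_of_le_one_right (by positivity) ((div_le_one W_pos).2 W_ge)
    _ ≤ ∑ v ∈ S, ∑ w ∈ Sᶜ, adjacency G v w := hG.le_cut S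

theorem exists_targetAveragedHittingTime_eq [NeZero N] (hρ : 0 < ρ) :
    ∃ τ : ℝ, (N - 2 ≤ τ ∧ τ ≤ N * (1 + 2 / d + 1024 * d / (ρ * N) ^ 2)) ∧
      ∀ v, targetAveragedHittingTime G v = ENNReal.ofReal τ := by
  have N_pos : (0 : ℝ) < N := by exact_mod_cast (NeZero.pos N)
  have chain := isReversibleChain_stepKernel (hG.degree_ne_zero hd)
  have gap := chain.hasSpectralGap_of_hasConductance (by positivity) (hG.hasConductance hd hρ.le)
  have gap_pos : 0 < (ρ * N / (8 * d)) ^ 2 / 8 := by positivity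
  refine ⟨(greenMatrix (transitionMatrix (stepKernel G)) (invariantVector G)).trace,
    ⟨?_, ?_⟩, fun v => ?_⟩
  · simpa using chain.card_sub_two_le_trace_greenMatrix gap_pos gap
  · refine (chain.trace_greenMatrix_le gap_pos gap (hG.transitionMatrix_le hd)).trans_eq ?_
    rw [Fintype.card_fin]
    field_simp
    ring
  · rw [← sum_mul_lintegral_entranceTime chain gap_pos gap v, targetAveragedHittingTime]
    simp only [invariantProb_eq_ofReal (hG.degree_ne_zero hd)]
    rfl

end IsExpanding

end RandomWalk

section RandomGraph

variable {N : ℕ}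

/-- The possible edges at `v`. -/
def starEdges (v : Fin N) : Finset (Sym2 (Fin N)) := Finset.univ.image fun w => s(v, w)

/-- The possible edges between `S` and its complement. -/
def cutEdges (S : Finset (Fin N)) : Finset (Sym2 (Fin N)) :=
  (S ×ˢ Sᶜ).image fun z => s(z.1, z.2)

/-- In a random graph with independent edges that are present with probabilities `θ`, all expected
degrees equal `d`, and all cuts have expected edge density at least `r`. -/
structure IsExpandingOnAverage (d r : ℝ) (θ : Sym2 (Fin N) → unitInterval) : Prop where
  sum_star : ∀ v, ∑ e ∈ starEdges v, (θ e : ℝ) = d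
  le_sum_cut : ∀ S : Finset (Fin N), r * (S.card * (Sᶜ).card) ≤ ∑ e ∈ cutEdges S, (θ e : ℝ)

lemma sum_starEdges (v : Fin N) (f : Sym2 (Fin N) → ℝ) :
    ∑ e ∈ starEdges v, f e = ∑ w, f s(v, w) :=
  Finset.sum_image fun _ _ _ _ h => Sym2.congr_right.1 h

lemma sum_cutEdges (S : Finset (Fin N)) (f : Sym2 (Fin N) → ℝ) :
    ∑ e ∈ cutEdges S, f e = ∑ v ∈ S, ∑ w ∈ Sᶜ, f s(v, w) := by
  rw [cutEdges, Finset.sum_image, Finset.sum_product]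
  rintro ⟨a, b⟩ hab ⟨c, d⟩ hcd h
  simp only [Finset.coe_product, Set.mem_prod, Finset.mem_coe, Finset.mem_compl] at hab hcd
  rcases Sym2.eq_iff.1 h with ⟨rfl, rfl⟩ | ⟨rfl, rfl⟩
  · rfl
  · exact absurd hab.1 hcd.2

lemma cutEdges_compl (S : Finset (Fin N)) : cutEdges Sᶜ = cutEdges S := by
  ext e
  simp only [cutEdges, compl_compl, Finset.mem_image, Finset.mem_product, Prod.exists]
  constructor <;> exact fun ⟨v, w, hvw, he⟩ => ⟨w, v, hvw.symm, Sym2.eq_swap.trans he⟩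

lemma trueCount_starEdges (v : Fin N) (G : EdgeConfig N) :
    trueCount (starEdges v) G = degree G v := by
  rw [trueCount, sum_starEdges, ← sum_adjacency]
  rfl

lemma trueCount_cutEdges (S : Finset (Fin N)) (G : EdgeConfig N) :
    trueCount (cutEdges S) G = ∑ v ∈ S, ∑ w ∈ Sᶜ, adjacency G v w := by
  rw [trueCount, sum_cutEdges]
  rfl

/-- The nonempty sets containing at most half of the vertices. -/
def smallSets (N : ℕ) : Finset (Finset (Fin N)) := {S | S.Nonempty ∧ 2 * S.card ≤ N}

lemma compl_mem_smallSets {S : Finset (Fin N)} (hS : Sᶜ.Nonempty) (h : N < 2 * S.card) :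
    Sᶜ ∈ smallSets N := by
  have := S.card_add_card_compl
  rw [Fintype.card_fin] at this
  simp only [smallSets, Finset.mem_filter_univ]
  exact ⟨hS, by lia⟩

lemma sum_smallSets_pow_card_le {x : ℝ} (hx : 0 ≤ x) :
    ∑ S ∈ smallSets N, x ^ S.card ≤ (1 + x) ^ N - 1 := by
  have all_sets := Fintype.sum_pow_mul_eq_add_pow (Fin N) x 1
  simp only [one_pow, mul_one, Fintype.card_fin] at all_sets
  have empty_notMem : ∅ ∉ smallSets N := by simp [smallSets]
  rw [le_sub_iff_add_le, add_comm 1 x, ← all_sets]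
  calc ∑ S ∈ smallSets N, x ^ S.card + 1 = ∑ S ∈ insert ∅ (smallSets N), x ^ S.card := by
        rw [Finset.sum_insert empty_notMem, Finset.card_empty, pow_zero, add_comm]
    _ ≤ ∑ S : Finset (Fin N), x ^ S.card :=
        Finset.sum_le_sum_of_subset_of_nonneg (Finset.subset_univ _)
          fun S _ _ => pow_nonneg hx _

namespace IsExpandingOnAverage

variable {d r : ℝ} {θ : Sym2 (Fin N) → unitInterval} (hθ : IsExpandingOnAverage d r θ)
include hθ

lemma isExpanding {G : EdgeConfig N} (hmin : ∀ v, d / 2 ≤ trueCount (starEdges v) G)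
    (hmax : ∀ v, trueCount (starEdges v) G ≤ 2 * d)
    (hcut : ∀ S ∈ smallSets N, (∑ e ∈ cutEdges S, (θ e : ℝ)) / 2 ≤ trueCount (cutEdges S) G) :
    IsExpanding d (r / 2) G := by
  simp only [trueCount_starEdges] at hmin hmax
  refine ⟨hmin, hmax, fun S => ?_⟩
  rw [← trueCount_cutEdges]
  have average := hθ.le_sum_cut S
  rcases S.eq_empty_or_nonempty with rfl | hS
  · simp [cutEdges, trueCount]
  rcases (Sᶜ).eq_empty_or_nonempty with hS' | hS'
  · simp [cutEdges, trueCount, hS']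
  rcases le_or_gt (2 * S.card) N with hle | hgt
  · linarith [hcut S (by simp [smallSets, hS, hle])]
  · have := hcut Sᶜ (compl_mem_smallSets hS' hgt)
    rw [cutEdges_compl] at this
    linarith

lemma measureReal_cut_le (hr : 0 ≤ r) {S : Finset (Fin N)} (hS : S ∈ smallSets N) :
    (bernoulliProduct θ).real
      {G | trueCount (cutEdges S) G ≤ (∑ e ∈ cutEdges S, (θ e : ℝ)) / 2} ≤
        Real.exp (-(r * N) / 20) ^ S.card := by
  have card_compl : (N / 2 : ℝ) ≤ (Sᶜ).card := by
    have half : 2 * S.card ≤ N := (Finset.mem_filter.1 hS).2.2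
    have total := S.card_add_card_compl
    rw [Fintype.card_fin] at total
    have : N ≤ 2 * (Sᶜ).card := by lia
    have : (N : ℝ) ≤ 2 * (Sᶜ).card := by exact_mod_cast this
    linarith
  have average : r * (S.card * (N / 2)) ≤ ∑ e ∈ cutEdges S, (θ e : ℝ) :=
    le_trans (by gcongr) (hθ.le_sum_cut S)
  refine (measureReal_trueCount_le_half_le θ _).trans ?_
  rw [← Real.exp_nat_mul, Real.exp_le_exp]
  linarith

theorem measureReal_not_isExpanding_le (hr : 0 ≤ r) :
    (bernoulliProduct θ).real {G | ¬ IsExpanding d (r / 2) G} ≤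
      2 * N * Real.exp (-d / 10) + ((1 + Real.exp (-(r * N) / 20)) ^ N - 1) := by
  set μ := bernoulliProduct θ
  set lowDegree := ⋃ v : Fin N, {G : EdgeConfig N | trueCount (starEdges v) G ≤ d / 2}
  set highDegree := ⋃ v : Fin N, {G : EdgeConfig N | 2 * d ≤ trueCount (starEdges v) G}
  set sparseCut := ⋃ S ∈ smallSets N,
    {G : EdgeConfig N | trueCount (cutEdges S) G ≤ (∑ e ∈ cutEdges S, (θ e : ℝ)) / 2}
  have subset : {G | ¬ IsExpanding d (r / 2) G} ⊆ lowDegree ∪ highDegree ∪ sparseCut := by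
    intro G hG
    by_contra good
    simp only [lowDegree, highDegree, sparseCut, Set.mem_union, Set.mem_iUnion, Set.mem_ofPred_eq,
      not_or, not_exists, not_le] at good
    exact hG <| hθ.isExpanding (fun v => (good.1.1 v).le) (fun v => (good.1.2 v).le)
      fun S hS => (good.2 S hS).le
  have low : μ.real lowDegree ≤ N * Real.exp (-d / 10) := by
    refine (measureReal_iUnion_fintype_le _).trans ?_
    have (v : Fin N) := measureReal_trueCount_le_half_le θ (starEdges v)
    simp only [hθ.sum_star] at this
    simpa using Finset.sum_le_sum fun v (_ : v ∈ Finset.univ) => this v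
  have high : μ.real highDegree ≤ N * Real.exp (-d / 10) := by
    refine (measureReal_iUnion_fintype_le _).trans ?_
    have (v : Fin N) := measureReal_two_mul_le_trueCount_le θ (starEdges v)
    simp only [hθ.sum_star] at this
    simpa using Finset.sum_le_sum fun v (_ : v ∈ Finset.univ) => this v
  have sparse : μ.real sparseCut ≤ (1 + Real.exp (-(r * N) / 20)) ^ N - 1 :=
    (measureReal_biUnion_finset_le _ _).trans <|
      (Finset.sum_le_sum fun S hS => hθ.measureReal_cut_le hr hS).trans <|
        sum_smallSets_pow_card_le (Real.exp_pos _).le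
  have union := (measureReal_union_le (μ := μ) (lowDegree ∪ highDegree) sparseCut).trans
    (add_le_add_left (measureReal_union_le _ _) _)
  linarith [measureReal_mono (μ := μ) subset]

end IsExpandingOnAverage

end RandomGraph

section EqualBlocks

variable {N M : ℕ} {B : Fin N → Fin M} {p q : unitInterval}
  (hB : ∀ m : Fin M, (Finset.univ.filter fun v => B v = m).card = N / M)
include hB

lemma cast_card_block (m : Fin M) : ((Finset.univ.filter fun v => B v = m).card : ℝ) = N / M := by
  have total : N = M * (N / M) := by
    have := Finset.card_eq_sum_card_fiberwise (f := B) (s := Finset.univ) (t := Finset.univ)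
      (by simp)
    simpa [hB] using this
  rw [hB, Nat.cast_div ⟨_, total⟩ (by exact_mod_cast m.pos.ne')]

lemma sum_edgeProb_starEdges (v : Fin N) :
    ∑ e ∈ starEdges v, (edgeProb B p q e : ℝ) =
      (N * (p : ℝ) + N * ((M : ℝ) - 1) * (q : ℝ)) / M := by
  have M_ne : (M : ℝ) ≠ 0 := by exact_mod_cast (B v).pos.ne'
  have prob (w : Fin N) : (edgeProb B p q s(v, w) : ℝ) =
      q + if B w = B v then (p : ℝ) - q else 0 := by
    rcases eq_or_ne (B v) (B w) with hvw | hvw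
    · simp [edgeProb, hvw]
    · simp [edgeProb, hvw, hvw.symm]
  rw [sum_starEdges]
  simp only [prob, Finset.sum_add_distrib, ← Finset.sum_filter, Finset.sum_const, nsmul_eq_mul,
    cast_card_block hB, Finset.card_univ, Fintype.card_fin]
  field_simp
  ring

lemma sum_same_block_le (S : Finset (Fin N)) :
    ∑ v ∈ S, ∑ w ∈ Sᶜ, (if B v = B w then (1 : ℝ) else 0) ≤ S.card * (Sᶜ).card / M := by
  rcases S.eq_empty_or_nonempty with rfl | ⟨v₀, -⟩
  · simp
  have M_pos : (0 : ℝ) < M := by exact_mod_cast (B v₀).pos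
  set s : Fin M → ℝ := fun m => ((S.filter fun v => B v = m).card : ℝ)
  have block_compl (v : Fin N) : ∑ w ∈ Sᶜ, (if B v = B w then (1 : ℝ) else 0) =
      N / M - s (B v) := by
    have inside : s (B v) = ∑ w ∈ S, if B w = B v then 1 else 0 := (Finset.sum_boole ..).symm
    rw [← cast_card_block hB (B v), eq_sub_iff_add_eq', inside, ← Finset.sum_boole,
      ← Finset.sum_add_sum_compl S]
    simp only [eq_comm]
  have sum_s : ∑ m, s m = S.card := by
    have := Finset.card_eq_sum_card_fiberwise (f := B) (s := S) (t := Finset.univ) (by simp)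
    simp only [s, this, Nat.cast_sum]
  have sum_sq : ∑ v ∈ S, s (B v) = ∑ m, s m ^ 2 := by
    rw [← Finset.sum_fiberwise S B]
    refine Finset.sum_congr rfl fun m _ => ?_
    rw [Finset.sum_congr rfl fun v hv => congrArg s (Finset.mem_filter.1 hv).2, Finset.sum_const,
      nsmul_eq_mul, sq]
  have cauchy_schwarz : (S.card : ℝ) ^ 2 ≤ M * ∑ m, s m ^ 2 := by
    simpa [sum_s] using sq_sum_le_card_mul_sum_sq (s := Finset.univ) (f := s)
  have card_compl : ((Sᶜ).card : ℝ) = N - S.card := by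
    rw [eq_sub_iff_add_eq']
    exact_mod_cast S.card_add_card_compl.trans (Fintype.card_fin N)
  simp only [block_compl, Finset.sum_sub_distrib, Finset.sum_const, sum_sq, nsmul_eq_mul]
  rw [le_div_iff₀ M_pos, card_compl, sub_mul, mul_assoc, div_mul_cancel₀ _ M_pos.ne']
  linarith

lemma le_sum_edgeProb_cutEdges (hM : 2 ≤ M) (S : Finset (Fin N)) :
    (q : ℝ) / 2 * (S.card * (Sᶜ).card) ≤ ∑ e ∈ cutEdges S, (edgeProb B p q e : ℝ) := by
  have prob (v w : Fin N) :
      (q : ℝ) - q * (if B v = B w then 1 else 0) ≤ edgeProb B p q s(v, w) := by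
    by_cases hvw : B v = B w
    · simpa [edgeProb, hvw] using p.2.1
    · simp [edgeProb, hvw]
  have same_block : ∑ v ∈ S, ∑ w ∈ Sᶜ, (if B v = B w then (1 : ℝ) else 0) ≤
      S.card * (Sᶜ).card / 2 := by
    refine (sum_same_block_le hB S).trans ?_
    gcongr
    exact_mod_cast hM
  rw [sum_cutEdges]
  calc (q : ℝ) / 2 * (S.card * (Sᶜ).card)
      = (q : ℝ) * (S.card * (Sᶜ).card) - q * (S.card * (Sᶜ).card / 2) := by ring
    _ ≤ (q : ℝ) * (S.card * (Sᶜ).card) -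
          q * ∑ v ∈ S, ∑ w ∈ Sᶜ, (if B v = B w then (1 : ℝ) else 0) := by
        gcongr
        exact q.2.1
    _ = ∑ v ∈ S, ∑ w ∈ Sᶜ, ((q : ℝ) - q * (if B v = B w then 1 else 0)) := by
        simp only [Finset.sum_sub_distrib, ← Finset.mul_sum, Finset.sum_const, nsmul_eq_mul]
        ring
    _ ≤ ∑ v ∈ S, ∑ w ∈ Sᶜ, (edgeProb B p q s(v, w) : ℝ) :=
        Finset.sum_le_sum fun v _ => Finset.sum_le_sum fun w _ => prob v w

lemma isExpandingOnAverage_of_two_le (hM : 2 ≤ M) :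
    IsExpandingOnAverage ((N * (p : ℝ) + N * ((M : ℝ) - 1) * (q : ℝ)) / M) (q / 2)
      (edgeProb B p q) :=
  ⟨sum_edgeProb_starEdges hB, le_sum_edgeProb_cutEdges hB hM⟩

omit hB in
lemma isExpandingOnAverage_of_subsingleton [Subsingleton (Fin M)] :
    IsExpandingOnAverage (N * p) p (edgeProb B p q) := by
  have prob (v w : Fin N) : edgeProb B p q s(v, w) = p := if_pos (Subsingleton.elim _ _)
  constructor
  · simp [sum_starEdges, prob]
  · intro S
    rw [sum_cutEdges]
    simp only [prob, Finset.sum_const, nsmul_eq_mul]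
    exact le_of_eq (by ring)

end EqualBlocks

section Asymptotics

/-- The expected degree `d` and the number `s = rN`, where `r` is a lower bound for the expected
density of all cuts, dominate `L = log N`, and `s ^ 2` dominates `d`, all with constant `C`. -/
structure IsDenseRegime (C L d s : ℝ) : Prop where
  le_degree : L ≤ C * d
  le_cut : L ≤ C * s
  degree_le : d ≤ C * s ^ 2

lemma isDenseRegime_of_le {c L x y m : ℝ} (hc : 0 < c) (hc1 : c ≤ 1) (hL : 1 ≤ L) (hm : 1 ≤ m)
    (hx : 0 ≤ x) (hy : 0 ≤ y) (hdeg : m * L ≤ c * (x + (m - 1) * y))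
    (hcut : x * L ≤ c ^ 2 * y ^ 2 * m) :
    IsDenseRegime (12 * c) L ((x + (m - 1) * y) / m) (y / 2) := by
  have m_pos : 0 < m := by linarith
  have : 0 ≤ (x + (m - 1) * y) / m :=
    div_nonneg (add_nonneg hx (mul_nonneg (by linarith) hy)) m_pos.le
  have le_degree : L ≤ c * ((x + (m - 1) * y) / m) := by
    rwa [← mul_div_assoc, le_div_iff₀ m_pos, mul_comm L]
  -- Otherwise the edges inside and outside a block would contribute at most `L / 4` and `L / 2`
  -- to `c * d ≥ L`.
  have le_cut : L ≤ 2 * c * y := by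
    by_contra! hlt
    have inside : c * (x * L) ≤ m * (L / 2) ^ 2 := by
      calc c * (x * L) ≤ 1 * (x * L) := by gcongr
        _ ≤ m * (c * y) ^ 2 := by linarith
        _ ≤ m * (L / 2) ^ 2 := by gcongr; linarith
    have outside : c * ((m - 1) * y) * L ≤ m * (L / 2) * L := by
      have : c * ((m - 1) * y) ≤ m * (L / 2) := by nlinarith [mul_nonneg hc.le hy]
      gcongr
    have scaled : m * L * L ≤ c * (x + (m - 1) * y) * L := by gcongr
    nlinarith [mul_pos m_pos (mul_pos (zero_lt_one.trans_le hL) (zero_lt_one.trans_le hL))]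
  refine ⟨by nlinarith, by linarith, ?_⟩
  rw [div_le_iff₀ m_pos]
  have inside : x ≤ c * y ^ 2 * m := by
    calc x ≤ x * L := le_mul_of_one_le_right hx hL
      _ ≤ c ^ 2 * y ^ 2 * m := hcut
      _ ≤ c * y ^ 2 * m := by gcongr; nlinarith
  have outside : (m - 1) * y ≤ 2 * c * y ^ 2 * m := by
    calc (m - 1) * y ≤ m * y * 1 := by linarith
      _ ≤ m * y * (2 * c * y) := by gcongr; linarith
      _ = 2 * c * y ^ 2 * m := by ring
  linarith

lemma isDenseRegime_self_of_le {c L x : ℝ} (hc : 0 < c) (hL : 1 ≤ L) (hdeg : L ≤ c * x) :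
    IsDenseRegime (12 * c) L x x := by
  have : 0 < x := pos_of_mul_pos_right (by linarith) hc.le
  constructor <;> nlinarith

lemma natCast_pos_of_one_le_log {N : ℕ} (hN : 1 ≤ Real.log N) : (0 : ℝ) < N := by
  refine Nat.cast_pos.2 (Nat.pos_of_ne_zero ?_)
  rintro rfl
  norm_num at hN

lemma exists_isExpandingOnAverage {N M : ℕ} {B : Fin N → Fin M} {p q : unitInterval}
    (hB : ∀ m : Fin M, (Finset.univ.filter fun v => B v = m).card = N / M) (hM : 0 < M)
    {c : ℝ} (hc : 0 < c) (hc1 : c ≤ 1) (hL : 1 ≤ Real.log N)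
    (hconn : M * Real.log N ≤ c * (N * (p : ℝ) + N * ((M : ℝ) - 1) * (q : ℝ)))
    (hq : √((p : ℝ) * Real.log N / (N * M)) ≤ c * q) :
    ∃ d r : ℝ, IsExpandingOnAverage d r (edgeProb B p q) ∧
      IsDenseRegime (12 * c) (Real.log N) d (r * N) := by
  have p_nonneg := p.2.1
  have q_nonneg := q.2.1
  rcases Nat.lt_or_ge 1 M with hM2 | hM1
  · refine ⟨_, _, isExpandingOnAverage_of_two_le hB hM2, ?_⟩
    rw [mul_assoc (N : ℝ), mul_left_comm (N : ℝ)] at hconn ⊢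
    rw [div_mul_eq_mul_div, mul_comm (q : ℝ)]
    refine isDenseRegime_of_le hc hc1 hL (by exact_mod_cast hM) (by positivity) (by positivity)
      hconn ?_
    have N_pos := natCast_pos_of_one_le_log hL
    have := (Real.sqrt_le_iff.1 hq).2
    rw [div_le_iff₀ (by positivity)] at this
    calc N * (p : ℝ) * Real.log N = N * (p * Real.log N) := by ring
      _ ≤ N * ((c * q) ^ 2 * (N * M)) := by gcongr
      _ = c ^ 2 * (N * (q : ℝ)) ^ 2 * M := by ring
  · obtain rfl : M = 1 := by lia
    refine ⟨_, _, isExpandingOnAverage_of_subsingleton, ?_⟩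
    rw [mul_comm (p : ℝ)]
    exact isDenseRegime_self_of_le hc hL (by simpa using hconn)

lemma IsExpanding.abs_targetAveragedHittingTime_div_sub_one_le {N : ℕ} {G : EdgeConfig N}
    {C L d r ε : ℝ} (hG : IsExpanding d (r / 2) G) (hC : 0 < C) (hL : 1 ≤ L)
    (hreg : IsDenseRegime C L d (r * N)) (hε : 4098 * C ≤ ε) (hN : 2 ≤ ε * N) (v : Fin N) :
    targetAveragedHittingTime G v ≠ ∞ ∧
      |(targetAveragedHittingTime G v).toReal / N - 1| ≤ ε := by
  have : NeZero N := ⟨v.pos.ne'⟩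
  have N_pos : (0 : ℝ) < N := by exact_mod_cast v.pos
  have d_pos : 0 < d := pos_of_mul_pos_right (by linarith [hreg.le_degree]) hC.le
  have s_pos : 0 < r * N := pos_of_mul_pos_right (by linarith [hreg.le_cut]) hC.le
  have r_pos : 0 < r := pos_of_mul_pos_left s_pos N_pos.le
  obtain ⟨τ, ⟨τ_ge, τ_le⟩, hτ⟩ :=
    hG.exists_targetAveragedHittingTime_eq d_pos (half_pos r_pos)
  have degree_term : 2 / d ≤ 2 * C := by
    rw [div_le_iff₀ d_pos]
    linarith [hreg.le_degree]
  have gap_term : 1024 * d / (r / 2 * N) ^ 2 ≤ 4096 * C := by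
    rw [div_le_iff₀ (by positivity)]
    linarith [hreg.degree_le]
  have upper : τ ≤ N * (1 + ε) := τ_le.trans (mul_le_mul_of_nonneg_left (by linarith) N_pos.le)
  have lower : N * (1 - ε) ≤ τ := by linarith
  rw [hτ v]
  refine ⟨ENNReal.ofReal_ne_top, ?_⟩
  rcases le_or_gt 0 τ with τ_nonneg | τ_neg
  · rw [ENNReal.toReal_ofReal τ_nonneg, abs_sub_le_iff, sub_le_iff_le_add', sub_le_comm,
      div_le_iff₀' N_pos, le_div_iff₀' N_pos]
    exact ⟨upper, lower⟩
  · have : 1 < ε := by nlinarith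
    simpa [ENNReal.ofReal_of_nonpos τ_neg.le] using this.le

lemma mul_exp_neg_le_inv {x t : ℝ} (hx : 0 < x) (ht : 2 * Real.log x ≤ t) :
    x * Real.exp (-t) ≤ x⁻¹ := by
  calc x * Real.exp (-t) ≤ x * Real.exp (-(2 * Real.log x)) := by gcongr
    _ = x⁻¹ := by
      rw [← Real.log_rpow hx, Real.exp_neg, Real.exp_log (Real.rpow_pos_of_pos hx 2)]
      norm_cast
      field_simp

lemma IsExpandingOnAverage.measureReal_not_isExpanding_le_of_isDenseRegime {N : ℕ} {C d r : ℝ}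
    {θ : Sym2 (Fin N) → unitInterval} (hθ : IsExpandingOnAverage d r θ) (hC : 0 < C)
    (hC' : C ≤ 1 / 40) (hN : 1 ≤ Real.log N) (hreg : IsDenseRegime C (Real.log N) d (r * N)) :
    (bernoulliProduct θ).real {G | ¬ IsExpanding d (r / 2) G} ≤
      2 * (N : ℝ)⁻¹ + (Real.exp (N : ℝ)⁻¹ - 1) := by
  have N_pos := natCast_pos_of_one_le_log hN
  have : 0 < d := pos_of_mul_pos_right (by linarith [hreg.le_degree]) hC.le
  have s_pos : 0 < r * N := pos_of_mul_pos_right (by linarith [hreg.le_cut]) hC.le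
  have degree_decay : N * Real.exp (-d / 10) ≤ (N : ℝ)⁻¹ := by
    rw [neg_div]
    exact mul_exp_neg_le_inv N_pos (by nlinarith [hreg.le_degree])
  have cut_decay : N * Real.exp (-(r * N) / 20) ≤ (N : ℝ)⁻¹ := by
    rw [neg_div]
    exact mul_exp_neg_le_inv N_pos (by nlinarith [hreg.le_cut])
  have cut_term : (1 + Real.exp (-(r * N) / 20)) ^ N ≤ Real.exp (N : ℝ)⁻¹ := by
    calc (1 + Real.exp (-(r * N) / 20)) ^ N ≤ Real.exp (Real.exp (-(r * N) / 20)) ^ N := by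
          rw [add_comm]
          exact pow_le_pow_left₀ (by positivity) (Real.add_one_le_exp _) N
      _ = Real.exp (N * Real.exp (-(r * N) / 20)) := (Real.exp_nat_mul _ _).symm
      _ ≤ Real.exp (N : ℝ)⁻¹ := Real.exp_le_exp.2 cut_decay
  have := hθ.measureReal_not_isExpanding_le (pos_of_mul_pos_left s_pos N_pos.le).le
  linarith

instance {N M : ℕ} (B : Fin N → Fin M) (p q : unitInterval) : IsProbabilityMeasure (law B p q) :=
  inferInstanceAs (IsProbabilityMeasure (bernoulliProduct _))

lemma ofReal_le_law_abs_div_sub_one_le {N M : ℕ} {B : Fin N → Fin M} {p q : unitInterval}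
    (hB : ∀ m : Fin M, (Finset.univ.filter fun v => B v = m).card = N / M) (hM : 0 < M)
    {C ε : ℝ} (hC : 0 < C) (hC' : C ≤ 1 / 40) (hε : 4098 * C ≤ ε) (hN : 1 ≤ Real.log N)
    (hεN : 2 ≤ ε * N)
    (hconn : M * Real.log N ≤ C / 12 * (N * (p : ℝ) + N * ((M : ℝ) - 1) * (q : ℝ)))
    (hq : √((p : ℝ) * Real.log N / (N * M)) ≤ C / 12 * q) :
    ENNReal.ofReal (1 - (2 * (N : ℝ)⁻¹ + (Real.exp (N : ℝ)⁻¹ - 1))) ≤ law B p q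
      {G | ∀ v, targetAveragedHittingTime G v ≠ ∞ ∧
        |(targetAveragedHittingTime G v).toReal / N - 1| ≤ ε} := by
  obtain ⟨d, r, hθ, hreg⟩ :=
    exists_isExpandingOnAverage hB hM (by positivity) (by linarith) hN hconn hq
  rw [mul_div_cancel₀ C (by norm_num)] at hreg
  have failure := hθ.measureReal_not_isExpanding_le_of_isDenseRegime hC hC' hN hreg
  have success : 1 - (law B p q).real {G | ¬ IsExpanding d (r / 2) G} =
      (law B p q).real {G | IsExpanding d (r / 2) G} := by
    rw [← probReal_compl_eq_one_sub .of_discrete, ← Set.compl_ofPred, compl_compl]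
  calc _ ≤ ENNReal.ofReal ((law B p q).real {G | IsExpanding d (r / 2) G}) :=
        ENNReal.ofReal_le_ofReal ((sub_le_sub_left failure 1).trans_eq success)
    _ = law B p q {G | IsExpanding d (r / 2) G} := ofReal_measureReal
    _ ≤ _ := measure_mono fun G hG =>
        hG.abs_targetAveragedHittingTime_div_sub_one_le hC hN hreg hε hεN

lemma log_isBigO_log_pow_four {N : ℕ → ℕ} (hN : Tendsto N atTop atTop) :
    (fun i => Real.log (N i)) =O[atTop] fun i => Real.log (N i) ^ 4 := by
  have log_atTop := Real.tendsto_log_atTop.comp (tendsto_natCast_atTop_atTop (R := ℝ).comp hN)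
  refine .of_bound' ?_
  filter_upwards [log_atTop.eventually_ge_atTop 1] with i log_ge
  rw [norm_pow]
  exact le_self_pow₀ (log_ge.trans (le_abs_self _)) (by norm_num)

end Asymptotics

end StochasticBlockModel

theorem theorem7p1_general
    (N M : ℕ → ℕ) (B : (i : ℕ) → Fin (N i) → Fin (M i)) (p q : ℕ → unitInterval)
    (hN : Tendsto N atTop atTop)
    (hB : ∀ i, ∀ m : Fin (M i), (Finset.univ.filter fun v => B i v = m).card = N i / M i)
    (hconn : (fun i => (M i : ℝ) * Real.log (N i)) =o[atTop]
      fun i => (N i : ℝ) * (p i : ℝ) + (N i : ℝ) * ((M i : ℝ) - 1) * (q i : ℝ))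
    (hq : (fun i => √((p i : ℝ) * Real.log (N i) / ((N i : ℝ) * (M i : ℝ)))) =o[atTop]
      fun i => (q i : ℝ)) :
    ∀ ε : ℝ, 0 < ε →
      Tendsto
        (fun i => StochasticBlockModel.law (B i) (p i) (q i)
          {G | ∀ v : Fin (N i),
            StochasticBlockModel.targetAveragedHittingTime G v ≠ ∞ ∧
            |(StochasticBlockModel.targetAveragedHittingTime G v).toReal / (N i : ℝ) - 1| ≤ ε})
        atTop (𝓝 1) := by
  intro ε hε
  obtain ⟨C, hC, hC'⟩ : ∃ C : ℝ, 0 < C ∧ C ≤ min (1 / 40) (ε / 4098) :=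
    ⟨_, lt_min (by norm_num) (by positivity), le_rfl⟩
  obtain ⟨C_le, C_le_ε⟩ := le_min_iff.1 hC'
  have N_atTop : Tendsto (fun i => (N i : ℝ)) atTop atTop := tendsto_natCast_atTop_atTop.comp hN
  have lower : Tendsto (fun i => ENNReal.ofReal
      (1 - (2 * (N i : ℝ)⁻¹ + (Real.exp (N i : ℝ)⁻¹ - 1)))) atTop (𝓝 1) := by
    have cont : Continuous fun x : ℝ => ENNReal.ofReal (1 - (2 * x + (Real.exp x - 1))) :=
      ENNReal.continuous_ofReal.comp (by fun_prop)
    simpa [Function.comp_def] using (cont.tendsto 0).comp (tendsto_inv_atTop_zero.comp N_atTop)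
  refine tendsto_of_tendsto_of_tendsto_of_le_of_le' lower tendsto_const_nhds ?_
    (.of_forall fun i => prob_le_one)
  filter_upwards [hconn.def (by positivity : 0 < C / 12), hq.def (by positivity : 0 < C / 12),
    hN.eventually_gt_atTop 0, (Real.tendsto_log_atTop.comp N_atTop).eventually_ge_atTop 1,
    (N_atTop.const_mul_atTop hε).eventually_ge_atTop 2] with i hconn hq N_pos log_ge hεN
  have M_pos : 0 < M i := (B i ⟨0, N_pos⟩).pos
  have M_sub_one_nonneg : (0 : ℝ) ≤ M i - 1 := sub_nonneg.2 (by exact_mod_cast M_pos)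
  have p_nonneg := (p i).2.1
  have q_nonneg := (q i).2.1
  rw [Real.norm_of_nonneg (by positivity), Real.norm_of_nonneg (by positivity)] at hconn hq
  exact StochasticBlockModel.ofReal_le_law_abs_div_sub_one_le (hB i) M_pos hC C_le (by linarith)
    log_ge hεN hconn hq

theorem theorem7p1
    (N M : ℕ → ℕ) (B : (i : ℕ) → Fin (N i) → Fin (M i)) (p q : ℕ → unitInterval)
    (hN : Tendsto N atTop atTop)
    (hM : (fun i => (M i : ℝ)) =o[atTop] fun i => (N i : ℝ))
    (hMN : ∀ i, M i ∣ N i)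
    (hB : ∀ i, ∀ m : Fin (M i), (Finset.univ.filter fun v => B i v = m).card = N i / M i)
    (hconn : (fun i => (M i : ℝ) * Real.log (N i) ^ 4) =o[atTop]
      fun i => (N i : ℝ) * (p i : ℝ) + (N i : ℝ) * ((M i : ℝ) - 1) * (q i : ℝ))
    (hq : (fun i => √((p i : ℝ) * Real.log (N i) / ((N i : ℝ) * (M i : ℝ)))) =o[atTop]
      fun i => (q i : ℝ))
    (κ : ℝ≥0∞)
    (hκ : Tendsto
      (fun i => ENNReal.ofReal (((M i : ℝ) - 1) * (q i : ℝ)) / ENNReal.ofReal (p i : ℝ))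
      atTop (𝓝 κ)) :
    ∀ ε : ℝ, 0 < ε →
      Tendsto
        (fun i => StochasticBlockModel.law (B i) (p i) (q i)
          {G | ∀ v : Fin (N i),
            StochasticBlockModel.targetAveragedHittingTime G v ≠ ∞ ∧
            |(StochasticBlockModel.targetAveragedHittingTime G v).toReal / (N i : ℝ) - 1| ≤ ε})
        atTop (𝓝 1) :=
  theorem7p1_general N M B p q hN hB
    (((isBigO_refl _ _).mul
      (StochasticBlockModel.log_isBigO_log_pow_four hN)).trans_isLittleO hconn) hq
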